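/- Let $\Delta$ be a nonnegative integer; all graphs are simple and undirected. Let $\mathbf{Gr}$ be the set of isomorphism classes $[G,o]$ of pairs $(G,o)$, where $G$ is a countable connected graph all of whose vertices have degree at most $\Delta$ and $o$ is a vertex of $G$ (isomorphisms preserve the root). Let $\vec{\mathbf{Gr}}$ be the set of isomorphism classes $[G,o_1,o_2]$ of triples, where $G$ is such a graph, $o_1$ is a vertex and $o_2\in N_G(o_1)$, the set of neighbours of $o_1$ (isomorphisms preserve both roots). Let $B_G(o,r)$ be the subgraph of $G$ induced by the vertices at graph distance at most $r$ from $o$. Give $\mathbf{Gr}$ the metric $\rho$ for which distinct classes $[G,o]$, $[H,p]$ have distance $2^{-r}$ with $$r=\sup\{s\in\mathbb N : [B_G(o,s),o]=[B_H(p,s),p]\},$$ and $\vec{\mathbf{Gr}}$ the metric $\vec\rho$ for which distinct classes $[G,o_1,o_2]$, $[H,p_1,p_2]$ have distance $2^{-r}$ with $$r=\sup\{s\in\mathbb N : [B_G(o_1,s),o_1,o_2]=[B_H(p_1,s),p_1,p_2]\}$$ (for $s=0$ the condition on the second roots, which lie outside the balls, is void). Equip both spaces with their Borel $\sigma$-algebras.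 A probability measure $\mu$ on $\mathbf{Gr}$ is called unimodular if $$\int \sum_{x\in N_G(o)} f[G,x,o]\,d\mu[G,o]=\int \sum_{x\in N_G(o)} f[G,o,x]\,d\mu[G,o]$$ for every Borel function $f:\vec{\mathbf{Gr}}\to[0,\infty)$, where both sides may be infinite. If $(\mu_n)_{n\ge 1}$ is a sequence of unimodular probability measures on $\mathbf{Gr}$ that converges weakly to a probability measure $\mu$ on $\mathbf{Gr}$ (that is, $\int g\,d\mu_n\to\int g\,d\mu$ for every bounded continuous $g:\mathbf{Gr}\to\mathbb R$), then $\mu$ is unimodular. -/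

import Mathlib

open MeasureTheory Filter Topology
open scoped ENNReal NNReal

namespace BoundedDegree

/-! ### Balls in a graph and the restriction of isomorphisms to balls -/

section Balls

/-- The vertex set of the ball of radius `r` around `o`, in the shortest path metric. -/
def ballSet {V : Type} (G : SimpleGraph V) (o : V) (r : ℕ) : Set V := {x | G.dist o x ≤ r}

/-- The ball `B_G(o, r)`: the subgraph induced on the vertices at distance at most `r` from `o`. -/
abbrev ballGraph {V : Type} (G : SimpleGraph V) (o : V) (r : ℕ) : SimpleGraph (ballSet G o r) :=
  G.induce (ballSet G o r)

theorem center_mem {V : Type} (G : SimpleGraph V) (o : V) (r : ℕ) : o ∈ ballSet G o r := by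
  simp [ballSet]

/-- There is an isomorphism from `B_G(o, r)` to `B_H(p, r)` that maps `o` to `p`, and that maps `a`
to `b` in case `a` belongs to the ball. -/
def BallIso {V W : Type} (G : SimpleGraph V) (o a : V) (H : SimpleGraph W) (p b : W) (r : ℕ) :
    Prop :=
  ∃ φ : ballGraph G o r ≃g ballGraph H p r,
    (φ ⟨o, center_mem G o r⟩ : W) = p ∧ ∀ h : a ∈ ballSet G o r, (φ ⟨a, h⟩ : W) = b

theorem exists_adj_dist {V : Type} {G : SimpleGraph V} (hG : G.Connected) {o x : V} {n : ℕ}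
    (h : G.dist o x = n + 1) : ∃ y, G.Adj y x ∧ G.dist o y = n := by
  obtain ⟨w, hw⟩ := hG.exists_walk_length_eq_dist x o
  rw [SimpleGraph.dist_comm, h] at hw
  cases w with
  | nil => simp at hw
  | cons hadj q =>
    rename_i y
    refine ⟨y, hadj.symm, ?_⟩
    have h1 : G.dist y o ≤ q.length := SimpleGraph.dist_le q
    have h2 : q.length = n := by simpa using hw
    have h3 : G.dist o x ≤ G.dist o y + G.dist y x := hG.dist_triangle
    have h4 : G.dist y x = 1 := SimpleGraph.dist_eq_one_iff_adj.2 hadj.symm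
    have h5 : G.dist y o = G.dist o y := SimpleGraph.dist_comm
    omega

theorem finite_ballSet {V : Type} {G : SimpleGraph V} (hG : G.Connected)
    (hfin : ∀ x, (G.neighborSet x).Finite) (o : V) (r : ℕ) : (ballSet G o r).Finite := by
  induction r with
  | zero =>
    refine (Set.finite_singleton o).subset fun x hx => ?_
    have : G.dist o x = 0 := Nat.le_zero.1 hx
    exact (hG.dist_eq_zero_iff.1 this).symm
  | succ n ih =>
    refine (ih.union (ih.biUnion fun y _ => hfin y)).subset fun x hx => ?_
    rcases Nat.lt_or_ge n (G.dist o x) with h | h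
    · obtain ⟨y, hy, hd⟩ := exists_adj_dist hG (le_antisymm hx h)
      exact Or.inr (Set.mem_biUnion (show y ∈ ballSet G o n from hd.le) hy)
    · exact Or.inl h

theorem dist_ballIso_le {V W : Type} {G : SimpleGraph V} {H : SimpleGraph W} (hG : G.Connected)
    (hH : H.Connected) {o : V} {p : W} {r : ℕ} (φ : ballGraph G o r ≃g ballGraph H p r)
    (h0 : (φ ⟨o, center_mem G o r⟩ : W) = p) (x : ballSet G o r) :
    H.dist p (φ x) ≤ G.dist o x := by
  obtain ⟨n, hn⟩ : ∃ n, G.dist o x = n := ⟨_, rfl⟩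
  induction n generalizing x with
  | zero =>
    have : x = ⟨o, center_mem G o r⟩ := Subtype.ext (hG.dist_eq_zero_iff.1 hn).symm
    simp [this, h0]
  | succ n ih =>
    obtain ⟨y, hy, hd⟩ := exists_adj_dist hG hn
    have hyr : y ∈ ballSet G o r := by
      have := x.2
      simp only [ballSet, Set.mem_ofPred_eq] at this ⊢
      omega
    have h1 := ih ⟨y, hyr⟩ hd
    have h2 : H.Adj (φ ⟨y, hyr⟩) (φ x) := φ.map_rel_iff.2 hy
    have h3 : H.dist p (φ x) ≤ H.dist p (φ ⟨y, hyr⟩) + H.dist (φ ⟨y, hyr⟩ : W) (φ x) :=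
      hH.dist_triangle
    rw [SimpleGraph.dist_eq_one_iff_adj.2 h2] at h3
    simp only at h1
    omega

theorem symm_center {V W : Type} {G : SimpleGraph V} {H : SimpleGraph W} {o : V} {p : W} {r : ℕ}
    (φ : ballGraph G o r ≃g ballGraph H p r) (h0 : (φ ⟨o, center_mem G o r⟩ : W) = p) :
    (φ.symm ⟨p, center_mem H p r⟩ : V) = o := by
  have : φ ⟨o, center_mem G o r⟩ = ⟨p, center_mem H p r⟩ := Subtype.ext h0
  rw [← this]
  simp

theorem dist_ballIso {V W : Type} {G : SimpleGraph V} {H : SimpleGraph W} (hG : G.Connected)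
    (hH : H.Connected) {o : V} {p : W} {r : ℕ} (φ : ballGraph G o r ≃g ballGraph H p r)
    (h0 : (φ ⟨o, center_mem G o r⟩ : W) = p) (x : ballSet G o r) :
    H.dist p (φ x) = G.dist o x := by
  refine le_antisymm (dist_ballIso_le hG hH φ h0 x) ?_
  simpa using dist_ballIso_le hH hG φ.symm (symm_center φ h0) (φ x)

theorem BallIso.symm {V W : Type} {G : SimpleGraph V} {H : SimpleGraph W} {o a : V} {p b : W}
    (hab : G.dist o a = H.dist p b) {r : ℕ} (h : BallIso G o a H p b r) :
    BallIso H p b G o a r := by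
  obtain ⟨φ, h0, h1⟩ := h
  refine ⟨φ.symm, symm_center φ h0, fun hb => ?_⟩
  have ha : a ∈ ballSet G o r := by simpa [ballSet, hab] using hb
  have : φ ⟨a, ha⟩ = ⟨b, hb⟩ := Subtype.ext (h1 ha)
  rw [← this]
  simp

theorem BallIso.trans {V W U : Type} {G : SimpleGraph V} {H : SimpleGraph W} {K : SimpleGraph U}
    {o a : V} {p b : W} {q c : U} (hab : G.dist o a = H.dist p b) {r : ℕ}
    (h : BallIso G o a H p b r) (h' : BallIso H p b K q c r) : BallIso G o a K q c r := by
  obtain ⟨φ, h0, h1⟩ := h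
  obtain ⟨ψ, k0, k1⟩ := h'
  refine ⟨φ.trans ψ, ?_, fun ha => ?_⟩
  · have : φ ⟨o, center_mem G o r⟩ = ⟨p, center_mem H p r⟩ := Subtype.ext h0
    simp [this, k0]
  · have hb : b ∈ ballSet H p r := by simpa [ballSet, hab] using ha
    have : φ ⟨a, ha⟩ = ⟨b, hb⟩ := Subtype.ext (h1 ha)
    simp [this, k1]

theorem BallIso.mono {V W : Type} {G : SimpleGraph V} {H : SimpleGraph W} (hG : G.Connected)
    (hH : H.Connected) {o a : V} {p b : W} {r s : ℕ} (hrs : r ≤ s) (h : BallIso G o a H p b s) :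
    BallIso G o a H p b r := by
  obtain ⟨φ, h0, h1⟩ := h
  have hsub : ∀ x, x ∈ ballSet G o r → x ∈ ballSet G o s := fun x hx => le_trans hx hrs
  have hsub' : ∀ x, x ∈ ballSet H p r → x ∈ ballSet H p s := fun x hx => le_trans hx hrs
  refine ⟨⟨⟨fun x => ⟨φ ⟨x, hsub x x.2⟩, ?_⟩, fun y => ⟨φ.symm ⟨y, hsub' y y.2⟩, ?_⟩, ?_, ?_⟩, ?_⟩,
    h0, fun ha => h1 (hsub a ha)⟩
  · have := dist_ballIso hG hH φ h0 ⟨x, hsub x x.2⟩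
    have hx := x.2
    simp only [ballSet, Set.mem_ofPred_eq] at this hx ⊢
    omega
  · have := dist_ballIso hH hG φ.symm (symm_center φ h0) ⟨y, hsub' y y.2⟩
    have hy := y.2
    simp only [ballSet, Set.mem_ofPred_eq] at this hy ⊢
    omega
  · intro x
    simp
  · intro y
    simp
  · intro x y
    exact φ.map_rel_iff (a := ⟨x, hsub x x.2⟩) (b := ⟨y, hsub y y.2⟩)

theorem BallIso.of_iso {V W : Type} {G : SimpleGraph V} {H : SimpleGraph W} (hG : G.Connected)
    (hH : H.Connected) {o a : V} {p b : W} (φ : G ≃g H) (h0 : φ o = p) (h1 : φ a = b) (r : ℕ) :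
    BallIso G o a H p b r := by
  have key : ∀ {V W : Type} {G : SimpleGraph V} {H : SimpleGraph W} (_ : G.Connected) {o : V}
      {p : W} (φ : G ≃g H), φ o = p → ∀ x, H.dist p (φ x) ≤ G.dist o x := by
    intro V W G H hG o p φ h0 x
    obtain ⟨w, hw⟩ := hG.exists_walk_length_eq_dist o x
    rw [← hw, ← h0, ← SimpleGraph.Walk.length_map φ.toHom w]
    exact SimpleGraph.dist_le _
  have hs : φ.symm p = o := by rw [← h0]; simp
  refine ⟨⟨⟨fun x => ⟨φ x, le_trans (key hG φ h0 x) x.2⟩,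
    fun y => ⟨φ.symm y, le_trans (key hH φ.symm hs y) y.2⟩, ?_, ?_⟩, ?_⟩, h0, fun _ => h1⟩
  · intro x
    simp
  · intro y
    simp
  · intro x y
    exact φ.map_rel_iff

/-- Locally finite connected graphs whose balls are all isomorphic are isomorphic. -/
theorem exists_iso_of_ballIso {V W : Type} {G : SimpleGraph V} {H : SimpleGraph W}
    (hG : G.Connected) (hH : H.Connected) (fG : ∀ x, (G.neighborSet x).Finite)
    (fH : ∀ x, (H.neighborSet x).Finite) {o a : V} {p b : W}
    (h : ∀ r, BallIso G o a H p b r) : ∃ φ : G ≃g H, φ o = p ∧ φ a = b := by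
  choose φ h0 h1 using h
  let U : Ultrafilter ℕ := hyperfilter ℕ
  have hU : ∀ n : ℕ, ∀ᶠ r in (U : Filter ℕ), n ≤ r := fun n =>
    Nat.hyperfilter_le_atTop (eventually_ge_atTop n)
  have lim1 : ∀ x : V, ∃ y : W, ∀ᶠ r in (U : Filter ℕ),
      ∃ hx : x ∈ ballSet G o r, (φ r ⟨x, hx⟩ : W) = y := by
    intro x
    have hev : ∀ᶠ r in (U : Filter ℕ), ∃ y ∈ ballSet H p (G.dist o x),
        ∃ hx : x ∈ ballSet G o r, (φ r ⟨x, hx⟩ : W) = y := by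
      filter_upwards [hU (G.dist o x)] with r hr
      exact ⟨φ r ⟨x, hr⟩, dist_ballIso_le hG hH (φ r) (h0 r) ⟨x, hr⟩, hr, rfl⟩
    obtain ⟨y, -, hy⟩ := (Ultrafilter.eventually_exists_mem_iff
      (finite_ballSet hH fH p (G.dist o x))).1 hev
    exact ⟨y, hy⟩
  have lim2 : ∀ y : W, ∃ x : V, ∀ᶠ r in (U : Filter ℕ),
      ∃ hy : y ∈ ballSet H p r, ((φ r).symm ⟨y, hy⟩ : V) = x := by
    intro y
    have hev : ∀ᶠ r in (U : Filter ℕ), ∃ x ∈ ballSet G o (H.dist p y),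
        ∃ hy : y ∈ ballSet H p r, ((φ r).symm ⟨y, hy⟩ : V) = x := by
      filter_upwards [hU (H.dist p y)] with r hr
      exact ⟨(φ r).symm ⟨y, hr⟩,
        dist_ballIso_le hH hG (φ r).symm (symm_center _ (h0 r)) ⟨y, hr⟩, hr, rfl⟩
    obtain ⟨x, -, hx⟩ := (Ultrafilter.eventually_exists_mem_iff
      (finite_ballSet hG fG o (H.dist p y))).1 hev
    exact ⟨x, hx⟩
  choose f hf using lim1
  choose g hg using lim2
  refine ⟨⟨⟨f, g, ?_, ?_⟩, ?_⟩, ?_, ?_⟩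
  · intro x
    obtain ⟨r, ⟨hx, e⟩, hy, e'⟩ := ((hf x).and (hg (f x))).exists
    have : (⟨f x, hy⟩ : ballSet H p r) = φ r ⟨x, hx⟩ := Subtype.ext e.symm
    rw [← e', this]
    simp
  · intro y
    obtain ⟨r, ⟨hy, e⟩, hx, e'⟩ := ((hg y).and (hf (g y))).exists
    have : (⟨g y, hx⟩ : ballSet G o r) = (φ r).symm ⟨y, hy⟩ := Subtype.ext e.symm
    rw [← e', this]
    simp
  · intro x y
    obtain ⟨r, ⟨hx, e⟩, hy, e'⟩ := ((hf x).and (hf y)).exists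
    change H.Adj (f x) (f y) ↔ G.Adj x y
    rw [← e, ← e']
    exact (φ r).map_rel_iff (a := ⟨x, hx⟩) (b := ⟨y, hy⟩)
  · obtain ⟨r, hx, e⟩ := (hf o).exists
    exact e.symm.trans (h0 r)
  · obtain ⟨r, hx, e⟩ := (hf a).exists
    exact e.symm.trans (h1 r hx)

end Balls

/-! ### The metric given by the largest radius of agreement -/

section Agreement

open Classical in
/-- The distance `2 ^ (-r)` between distinct points, where `r` is the supremum of the `s` for which
the relation `E s` holds between them (the supremum of the empty set of naturals being `0`). -/
noncomputable def agreementDist {X : Type*} (E : ℕ → X → X → Prop) (x y : X) : ℝ :=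
  if x = y then 0 else ((2 : ℝ) ^ sSup {s : ℕ | E s x y})⁻¹

theorem agreementDist_self {X : Type*} (E : ℕ → X → X → Prop) (x : X) :
    agreementDist E x x = 0 := by
  simp [agreementDist]

theorem agreementDist_comm {X : Type*} {E : ℕ → X → X → Prop}
    (hs : ∀ s x y, E s x y → E s y x) (x y : X) : agreementDist E x y = agreementDist E y x := by
  have : {s : ℕ | E s x y} = {s : ℕ | E s y x} := Set.ext fun s => ⟨hs s x y, hs s y x⟩
  by_cases h : x = y
  · simp [h]
  · simp [agreementDist, this, h, Ne.symm h]

theorem eq_of_agreementDist_eq_zero {X : Type*} {E : ℕ → X → X → Prop} {x y : X}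
    (h : agreementDist E x y = 0) : x = y := by
  by_contra hne
  simp [agreementDist, hne] at h

theorem bddAbove_agreement {X : Type*} {E : ℕ → X → X → Prop}
    (hm : ∀ r s x y, r ≤ s → E s x y → E r x y) (he : ∀ x y, (∀ s, E s x y) → x = y)
    {x y : X} (hne : x ≠ y) : BddAbove {s : ℕ | E s x y} := by
  obtain ⟨n, hn⟩ : ∃ n, ¬ E n x y := by
    by_contra! hall
    exact hne (he x y hall)
  refine ⟨n, fun s hs => ?_⟩
  by_contra! hlt
  exact hn (hm n s x y hlt.le hs)

theorem agreementDist_ultra {X : Type*} {E : ℕ → X → X → Prop}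
    (ht : ∀ s x y z, E s x y → E s y z → E s x z)
    (hm : ∀ r s x y, r ≤ s → E s x y → E r x y) (he : ∀ x y, (∀ s, E s x y) → x = y)
    (x y z : X) : agreementDist E x z ≤ max (agreementDist E x y) (agreementDist E y z) := by
  by_cases hxy : x = y
  · subst hxy; exact le_max_right _ _
  by_cases hyz : y = z
  · subst hyz; exact le_max_left _ _
  by_cases hxz : x = z
  · subst hxz
    rw [agreementDist_self]
    refine le_max_of_le_left ?_
    rw [agreementDist, if_neg hxy]
    positivity
  have main : min (sSup {s : ℕ | E s x y}) (sSup {s : ℕ | E s y z}) ≤ sSup {s : ℕ | E s x z} := by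
    rcases Set.eq_empty_or_nonempty {s : ℕ | E s x y} with h1 | h1
    · simp [h1]
    rcases Set.eq_empty_or_nonempty {s : ℕ | E s y z} with h2 | h2
    · simp [h2]
    have m1 : E (sSup {s : ℕ | E s x y}) x y := Nat.sSup_mem h1 (bddAbove_agreement hm he hxy)
    have m2 : E (sSup {s : ℕ | E s y z}) y z := Nat.sSup_mem h2 (bddAbove_agreement hm he hyz)
    exact le_csSup (bddAbove_agreement hm he hxz)
      (ht _ x y z (hm _ _ _ _ (min_le_left _ _) m1) (hm _ _ _ _ (min_le_right _ _) m2))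
  simp only [agreementDist, if_neg hxy, if_neg hyz, if_neg hxz]
  rcases min_le_iff.1 main with h | h
  · refine le_max_of_le_left (inv_anti₀ (by positivity) (pow_le_pow_right₀ (by norm_num) h))
  · refine le_max_of_le_right (inv_anti₀ (by positivity) (pow_le_pow_right₀ (by norm_num) h))

/-- The metric space structure with distance function `agreementDist E`. -/
@[reducible] noncomputable def agreementMetric {X : Type*} (E : ℕ → X → X → Prop)
    (hs : ∀ s x y, E s x y → E s y x) (ht : ∀ s x y z, E s x y → E s y z → E s x z)
    (hm : ∀ r s x y, r ≤ s → E s x y → E r x y) (he : ∀ x y, (∀ s, E s x y) → x = y) :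
    MetricSpace X where
  dist := agreementDist E
  dist_self := agreementDist_self E
  dist_comm := agreementDist_comm hs
  dist_triangle x y z := by
    have nn : ∀ u v : X, 0 ≤ agreementDist E u v := fun u v => by
      unfold agreementDist; split_ifs <;> positivity
    exact (agreementDist_ultra ht hm he x y z).trans (max_le_add_of_nonneg (nn x y) (nn y z))
  eq_of_dist_eq_zero := eq_of_agreementDist_eq_zero

end Agreement

/-! ### Rooted graphs and the space of their isomorphism classes -/

/-- A countable connected rooted graph all of whose degrees are at most `Δ`. -/
structure RootedGraph (Δ : ℕ) where
  /-- the vertex set -/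
  V : Type
  countable : Countable V
  /-- the graph, simple and undirected -/
  graph : SimpleGraph V
  connected : graph.Connected
  degree_le : ∀ x, (graph.neighborSet x).encard ≤ Δ
  /-- the root -/
  root : V

/-- A countable connected birooted graph all of whose degrees are at most `Δ`: there is a second
root, which is a neighbour of the first one. -/
structure BirootedGraph (Δ : ℕ) extends RootedGraph Δ where
  /-- the second root -/
  root₂ : V
  adj : graph.Adj root root₂

theorem RootedGraph.finite_neighborSet {Δ : ℕ} (G : RootedGraph Δ) (x : G.V) :
    (G.graph.neighborSet x).Finite :=
  Set.finite_of_encard_le_coe (G.degree_le x)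

/-- Isomorphism of rooted graphs. -/
instance rootedSetoid (Δ : ℕ) : Setoid (RootedGraph Δ) where
  r G H := ∃ φ : G.graph ≃g H.graph, φ G.root = H.root
  iseqv :=
    { refl := fun _ => ⟨RelIso.refl _, rfl⟩
      symm := fun ⟨φ, h⟩ => ⟨φ.symm, by rw [← h]; simp⟩
      trans := fun ⟨φ, h⟩ ⟨ψ, k⟩ => ⟨φ.trans ψ, by simp [h, k]⟩ }

/-- Isomorphism of birooted graphs. -/
instance birootedSetoid (Δ : ℕ) : Setoid (BirootedGraph Δ) where
  r G H := ∃ φ : G.graph ≃g H.graph, φ G.root = H.root ∧ φ G.root₂ = H.root₂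
  iseqv :=
    { refl := fun _ => ⟨RelIso.refl _, rfl, rfl⟩
      symm := fun ⟨φ, h, h'⟩ => ⟨φ.symm, by rw [← h]; simp, by rw [← h']; simp⟩
      trans := fun ⟨φ, h, h'⟩ ⟨ψ, k, k'⟩ => ⟨φ.trans ψ, by simp [h, k], by simp [h', k']⟩ }

/-- The set of isomorphism classes `[G, o]` of countable connected rooted graphs with degrees at
most `Δ`. -/
def Gr (Δ : ℕ) : Type 1 := Quotient (rootedSetoid Δ)

/-- The set of isomorphism classes `[G, o₁, o₂]` of countable connected birooted graphs with degrees
at most `Δ`. -/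
def BiGr (Δ : ℕ) : Type 1 := Quotient (birootedSetoid Δ)

/-- The isomorphism class `[G, o]`. -/
def RootedGraph.cls {Δ : ℕ} (G : RootedGraph Δ) : Gr Δ := Quotient.mk _ G

/-- The isomorphism class `[G, o₁, o₂]`. -/
def BirootedGraph.cls {Δ : ℕ} (G : BirootedGraph Δ) : BiGr Δ := Quotient.mk _ G

/-! ### The metric on rooted graphs -/

/-- `[B_G(o, r), o] = [B_H(p, r), p]`. -/
def RootedGraph.SameBall {Δ : ℕ} (r : ℕ) (G H : RootedGraph Δ) : Prop :=
  ∃ φ : ballGraph G.graph G.root r ≃g ballGraph H.graph H.root r,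
    φ ⟨G.root, center_mem _ _ r⟩ = ⟨H.root, center_mem _ _ r⟩

theorem RootedGraph.sameBall_iff {Δ : ℕ} {r : ℕ} {G H : RootedGraph Δ} :
    G.SameBall r H ↔ BallIso G.graph G.root G.root H.graph H.root H.root r :=
  ⟨fun ⟨φ, h⟩ => ⟨φ, congrArg Subtype.val h, fun _ => congrArg Subtype.val h⟩,
    fun ⟨φ, h, _⟩ => ⟨φ, Subtype.ext h⟩⟩

theorem RootedGraph.SameBall.symm {Δ : ℕ} {r : ℕ} {G H : RootedGraph Δ} (h : G.SameBall r H) :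
    H.SameBall r G :=
  RootedGraph.sameBall_iff.2 ((RootedGraph.sameBall_iff.1 h).symm (by simp))

theorem RootedGraph.SameBall.trans {Δ : ℕ} {r : ℕ} {G H K : RootedGraph Δ} (h : G.SameBall r H)
    (k : H.SameBall r K) : G.SameBall r K :=
  RootedGraph.sameBall_iff.2
    ((RootedGraph.sameBall_iff.1 h).trans (by simp) (RootedGraph.sameBall_iff.1 k))

theorem RootedGraph.sameBall_of_equiv {Δ : ℕ} (r : ℕ) {G H : RootedGraph Δ} (h : G ≈ H) :
    G.SameBall r H :=
  let ⟨φ, h⟩ := h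
  RootedGraph.sameBall_iff.2 (BallIso.of_iso G.connected H.connected φ h h r)

/-- The relation `[B_G(o, r), o] = [B_H(p, r), p]` between the classes `[G, o]` and `[H, p]`. -/
def Gr.SameBall {Δ : ℕ} (r : ℕ) (x y : Gr Δ) : Prop :=
  Quotient.liftOn₂ x y (RootedGraph.SameBall r) fun _ _ _ _ h k => propext
    ⟨fun e => ((RootedGraph.sameBall_of_equiv r h).symm.trans e).trans
        (RootedGraph.sameBall_of_equiv r k),
      fun e => ((RootedGraph.sameBall_of_equiv r h).trans e).trans
        (RootedGraph.sameBall_of_equiv r k).symm⟩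

/-- The metric `ρ`: distinct `[G, o]` and `[H, p]` have distance `2 ^ (-r)`, with `r` the supremum
of the `s` such that `[B_G(o, s), o] = [B_H(p, s), p]`. -/
noncomputable instance (Δ : ℕ) : MetricSpace (Gr Δ) :=
  agreementMetric Gr.SameBall
    (by rintro s ⟨G⟩ ⟨H⟩ h; exact RootedGraph.SameBall.symm h)
    (by rintro s ⟨G⟩ ⟨H⟩ ⟨K⟩ h k; exact RootedGraph.SameBall.trans h k)
    (by
      rintro r s ⟨G⟩ ⟨H⟩ hrs h
      exact RootedGraph.sameBall_iff.2
        ((RootedGraph.sameBall_iff.1 h).mono G.connected H.connected hrs))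
    (by
      rintro ⟨G⟩ ⟨H⟩ h
      obtain ⟨φ, h0, -⟩ := exists_iso_of_ballIso G.connected H.connected G.finite_neighborSet
        H.finite_neighborSet fun s => RootedGraph.sameBall_iff.1 (h s)
      exact Quotient.sound ⟨φ, h0⟩)

/-! ### The metric on birooted graphs -/

/-- `[B_G(o₁, r), o₁, o₂] = [B_H(p₁, r), p₁, p₂]`. For `r = 0` the second roots lie outside the balls
and the condition on them is void; this does not affect the metric defined below. -/
def BirootedGraph.SameBall {Δ : ℕ} (r : ℕ) (G H : BirootedGraph Δ) : Prop :=
  BallIso G.graph G.root G.root₂ H.graph H.root H.root₂ r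

theorem BirootedGraph.dist_eq {Δ : ℕ} (G H : BirootedGraph Δ) :
    G.graph.dist G.root G.root₂ = H.graph.dist H.root H.root₂ := by
  rw [SimpleGraph.dist_eq_one_iff_adj.2 G.adj, SimpleGraph.dist_eq_one_iff_adj.2 H.adj]

theorem BirootedGraph.SameBall.symm {Δ : ℕ} {r : ℕ} {G H : BirootedGraph Δ} (h : G.SameBall r H) :
    H.SameBall r G :=
  BallIso.symm (G.dist_eq H) h

theorem BirootedGraph.SameBall.trans {Δ : ℕ} {r : ℕ} {G H K : BirootedGraph Δ}
    (h : G.SameBall r H) (k : H.SameBall r K) : G.SameBall r K :=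
  BallIso.trans (G.dist_eq H) h k

theorem BirootedGraph.sameBall_of_equiv {Δ : ℕ} (r : ℕ) {G H : BirootedGraph Δ} (h : G ≈ H) :
    G.SameBall r H :=
  let ⟨φ, h, k⟩ := h
  BallIso.of_iso G.connected H.connected φ h k r

/-- The relation `[B_G(o₁, r), o₁, o₂] = [B_H(p₁, r), p₁, p₂]` between the classes `[G, o₁, o₂]` and
`[H, p₁, p₂]`. -/
def BiGr.SameBall {Δ : ℕ} (r : ℕ) (x y : BiGr Δ) : Prop :=
  Quotient.liftOn₂ x y (BirootedGraph.SameBall r) fun _ _ _ _ h k => propext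
    ⟨fun e => ((BirootedGraph.sameBall_of_equiv r h).symm.trans e).trans
        (BirootedGraph.sameBall_of_equiv r k),
      fun e => ((BirootedGraph.sameBall_of_equiv r h).trans e).trans
        (BirootedGraph.sameBall_of_equiv r k).symm⟩

/-- The metric on birooted graphs: distinct `[G, o₁, o₂]` and `[H, p₁, p₂]` have distance
`2 ^ (-r)`, with `r` the supremum of the `s` such that
`[B_G(o₁, s), o₁, o₂] = [B_H(p₁, s), p₁, p₂]`. -/
noncomputable instance (Δ : ℕ) : MetricSpace (BiGr Δ) :=
  agreementMetric BiGr.SameBall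
    (by rintro s ⟨G⟩ ⟨H⟩ h; exact BirootedGraph.SameBall.symm h)
    (by rintro s ⟨G⟩ ⟨H⟩ ⟨K⟩ h k; exact BirootedGraph.SameBall.trans h k)
    (by rintro r s ⟨G⟩ ⟨H⟩ hrs h; exact BallIso.mono G.connected H.connected hrs h)
    (by
      rintro ⟨G⟩ ⟨H⟩ h
      obtain ⟨φ, h0, h1⟩ := exists_iso_of_ballIso G.connected H.connected G.finite_neighborSet
        H.finite_neighborSet h
      exact Quotient.sound ⟨φ, h0, h1⟩)

theorem Gr.dist_def {Δ : ℕ} (x y : Gr Δ) : dist x y = agreementDist Gr.SameBall x y := rfl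

theorem BiGr.dist_def {Δ : ℕ} (x y : BiGr Δ) : dist x y = agreementDist BiGr.SameBall x y := rfl

/-- The Borel σ-algebra. -/
noncomputable instance (Δ : ℕ) : MeasurableSpace (Gr Δ) := borel _

instance (Δ : ℕ) : BorelSpace (Gr Δ) := ⟨rfl⟩

/-- The Borel σ-algebra. -/
noncomputable instance (Δ : ℕ) : MeasurableSpace (BiGr Δ) := borel _

instance (Δ : ℕ) : BorelSpace (BiGr Δ) := ⟨rfl⟩

/-! ### Unimodularity -/

/-- The birooted graph `(G, x, y)` on the graph underlying `G`, for adjacent vertices `x`, `y`. -/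
def RootedGraph.birooted {Δ : ℕ} (G : RootedGraph Δ) (x y : G.V) (h : G.graph.Adj x y) :
    BirootedGraph Δ :=
  { G with
    root := x
    root₂ := y
    adj := h }

/-- An isomorphism of rooted graphs restricts to a bijection between the neighbours of the roots. -/
def neighborEquiv {V W : Type} {G : SimpleGraph V} {H : SimpleGraph W} (φ : G ≃g H) {o : V} {p : W}
    (h : φ o = p) : G.neighborSet o ≃ H.neighborSet p :=
  φ.toEquiv.subtypeEquiv fun x => by
    subst h
    exact φ.map_rel_iff.symm

/-- `[G, o] ↦ ∑_{x ∈ N_G(o)} f [G, o, x]`; the neighbourhood is finite. -/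
noncomputable def outSum {Δ : ℕ} (f : BiGr Δ → ℝ≥0) (γ : Gr Δ) : ℝ≥0∞ :=
  Quotient.liftOn γ
    (fun G => ∑' x : G.graph.neighborSet G.root, (f (G.birooted G.root x x.2).cls : ℝ≥0∞))
    (by
      rintro G H ⟨φ, h⟩
      rw [← (neighborEquiv φ h).tsum_eq]
      refine tsum_congr fun x => congrArg (fun γ => (f γ : ℝ≥0∞)) (Quotient.sound ⟨φ, h, rfl⟩))

/-- `[G, o] ↦ ∑_{x ∈ N_G(o)} f [G, x, o]`; the neighbourhood is finite. -/
noncomputable def inSum {Δ : ℕ} (f : BiGr Δ → ℝ≥0) (γ : Gr Δ) : ℝ≥0∞ :=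
  Quotient.liftOn γ
    (fun G => ∑' x : G.graph.neighborSet G.root, (f (G.birooted x G.root x.2.symm).cls : ℝ≥0∞))
    (by
      rintro G H ⟨φ, h⟩
      rw [← (neighborEquiv φ h).tsum_eq]
      refine tsum_congr fun x => congrArg (fun γ => (f γ : ℝ≥0∞)) (Quotient.sound ⟨φ, rfl, h⟩))

/-- A measure on `Gr Δ` is unimodular if
`∫ ∑_{x ∈ N_G(o)} f [G, x, o] dμ[G, o] = ∫ ∑_{x ∈ N_G(o)} f [G, o, x] dμ[G, o]` for all nonnegative
real-valued Borel functions `f` on birooted graphs. Both sides are integrals of nonnegative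
functions and may be infinite. -/
def IsUnimodular {Δ : ℕ} (μ : Measure (Gr Δ)) : Prop :=
  ∀ f : BiGr Δ → ℝ≥0, Measurable f → ∫⁻ γ, inSum f γ ∂μ = ∫⁻ γ, outSum f γ ∂μ

end BoundedDegree

namespace BoundedDegree

/-! ### Sums over locally stable finite families of points -/

section PointFamily

variable {X Y : Type*} {ι : X → Type*}

/-! Unimodularity of `μ` is an equality of two measures on `BiGr Δ`: integrate over `μ` the sum of
Dirac masses at the classes `[G, x, o]`, respectively at the classes `[G, o, x]`, for `x ∈ N_G(o)`.
Both have total mass at most `Δ`, so they are finite Borel measures on a metric space and coincide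
as soon as they agree on bounded continuous functions.

For such an `f`, both `inSum f` and `outSum f` are bounded, by `Δ` times a bound of `f`, and
continuous: the ball of radius `r + 1` around `o` determines the neighbours of `o` together with the
balls of radius `r` around `o` and around each neighbour (`locallyStable_outward`,
`locallyStable_inward`). Weak convergence therefore carries the equality of integrals from `ν n` to
`μ` (`LocallyStable.tendsto_lintegral`), and equality of the two measures then gives it for every
Borel `f`. -/

/-- The family of finite multisets `b x` of points of `Y` varies continuously with `x`. -/
def LocallyStable [TopologicalSpace X] [PseudoMetricSpace Y] (b : ∀ x, ι x → Y) : Prop :=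
  ∀ x, ∀ ε > 0, ∀ᶠ y in 𝓝 x, ∃ e : ι x ≃ ι y, ∀ i, dist (b y (e i)) (b x i) < ε

/-- The index type changes with the point. Near `x`, however, the bijection `e` turns the family at
`y` into a tuple indexed by `ι x` that is close to `b x` in the sup metric, and on tuples with a
fixed finite index set the sum is continuous. -/
theorem LocallyStable.continuous_tsum [TopologicalSpace X] [PseudoMetricSpace Y]
    [∀ x, Finite (ι x)] {b : ∀ x, ι x → Y} (hb : LocallyStable b) {f : Y → ℝ≥0}
    (hf : Continuous f) : Continuous fun x => ∑' i, (f (b x i) : ℝ≥0∞) := by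
  refine continuous_iff_continuousAt.2 fun x => ?_
  have := Fintype.ofFinite (ι x)
  have hF : Continuous fun h : ι x → Y => ∑ i, (f (h i) : ℝ≥0∞) := by fun_prop
  intro W hW
  simp only [tsum_fintype] at hW
  obtain ⟨ε, hε, hW⟩ := Metric.mem_nhds_iff.1 (hF.continuousAt (x := b x) hW)
  refine mem_map.2 ?_
  filter_upwards [hb x ε hε] with y ⟨e, he⟩
  rw [Set.mem_preimage, ← e.tsum_eq, tsum_fintype]
  exact hW ((dist_pi_lt_iff hε).2 he)

/-- The sum of the Dirac measures at the points `b x i`. -/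
noncomputable def diracSum [MeasurableSpace Y] (b : ∀ x, ι x → Y) (x : X) : Measure Y :=
  Measure.sum fun i => Measure.dirac (b x i)

theorem lintegral_diracSum [MeasurableSpace Y] (b : ∀ x, ι x → Y) (x : X) {f : Y → ℝ≥0}
    (hf : Measurable f) : ∫⁻ y, f y ∂diracSum b x = ∑' i, (f (b x i) : ℝ≥0∞) := by
  rw [diracSum, lintegral_sum_measure]
  exact tsum_congr fun i => lintegral_dirac' _ hf.coe_nnreal_ennreal

theorem diracSum_univ [MeasurableSpace Y] (b : ∀ x, ι x → Y) (x : X) :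
    diracSum b x Set.univ = ENat.card (ι x) := by
  simp [diracSum, Measure.sum_apply]

instance [MeasurableSpace Y] [∀ x, Finite (ι x)] (b : ∀ x, ι x → Y) (x : X) :
    IsFiniteMeasure (diracSum b x) :=
  ⟨by rw [diracSum_univ]; simp⟩

/-- This makes `diracSum b` a kernel, so that `Measure.bind` applies. The mass of a closed set is a
pointwise limit of integrals of continuous functions approximating its indicator, and these
integrals are continuous in `x`. Closed sets form a π-system generating the Borel σ-algebra. -/
theorem LocallyStable.measurable_diracSum [TopologicalSpace X] [MeasurableSpace X]
    [OpensMeasurableSpace X] [PseudoMetricSpace Y] [MeasurableSpace Y] [BorelSpace Y]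
    [∀ x, Finite (ι x)] {b : ∀ x, ι x → Y} (hb : LocallyStable b) :
    Measurable (diracSum b) := by
  have key : ∀ F : Set Y, IsClosed F → Measurable fun x => diracSum b x F := by
    intro F hF
    refine measurable_of_tendsto_metrizable (f := fun n x => ∫⁻ y, hF.apprSeq n y ∂diracSum b x)
      (fun n => ?_) (tendsto_pi_nhds.2 fun x =>
      HasOuterApproxClosed.tendsto_lintegral_apprSeq hF (diracSum b x))
    simp_rw [lintegral_diracSum b _ (hF.apprSeq n).continuous.measurable]
    exact (hb.continuous_tsum (hF.apprSeq n).continuous).measurable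
  exact Measurable.measure_of_isPiSystem
    ((BorelSpace.measurable_eq (α := Y)).trans borel_eq_generateFrom_isClosed)
    isPiSystem_isClosed key (key _ isClosed_univ)

theorem LocallyStable.lintegral_bind [TopologicalSpace X] [MeasurableSpace X]
    [OpensMeasurableSpace X] [PseudoMetricSpace Y] [MeasurableSpace Y] [BorelSpace Y]
    [∀ x, Finite (ι x)] {b : ∀ x, ι x → Y} (hb : LocallyStable b) (μ : Measure X) {f : Y → ℝ≥0}
    (hf : Measurable f) :
    ∫⁻ y, f y ∂μ.bind (diracSum b) = ∫⁻ x, ∑' i, (f (b x i) : ℝ≥0∞) ∂μ := by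
  rw [Measure.lintegral_bind hb.measurable_diracSum.aemeasurable
    hf.coe_nnreal_ennreal.aemeasurable]
  simp_rw [lintegral_diracSum b _ hf]

theorem LocallyStable.isFiniteMeasure_bind [TopologicalSpace X] [MeasurableSpace X]
    [OpensMeasurableSpace X] [PseudoMetricSpace Y] [MeasurableSpace Y] [BorelSpace Y]
    [∀ x, Finite (ι x)] {b : ∀ x, ι x → Y} (hb : LocallyStable b) {D : ℕ}
    (hD : ∀ x, ENat.card (ι x) ≤ D) (μ : Measure X) [IsFiniteMeasure μ] :
    IsFiniteMeasure (μ.bind (diracSum b)) := by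
  refine ⟨?_⟩
  rw [Measure.bind_apply MeasurableSet.univ hb.measurable_diracSum.aemeasurable]
  calc ∫⁻ x, diracSum b x Set.univ ∂μ ≤ ∫⁻ _, (D : ℝ≥0∞) ∂μ := by
        refine lintegral_mono fun x => ?_
        rw [diracSum_univ]
        simpa using ENat.toENNReal_le.2 (hD x)
    _ < ∞ := by
        rw [lintegral_const]
        exact ENNReal.mul_lt_top (ENNReal.natCast_lt_top D) (measure_lt_top μ _)

theorem LocallyStable.tendsto_lintegral [TopologicalSpace X] [MeasurableSpace X]
    [OpensMeasurableSpace X] [PseudoMetricSpace Y]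
    [∀ x, Finite (ι x)] {b : ∀ x, ι x → Y} (hb : LocallyStable b) {D : ℕ}
    (hD : ∀ x, ENat.card (ι x) ≤ D) {ν : ℕ → ProbabilityMeasure X} {μ : ProbabilityMeasure X}
    (hlim : Tendsto ν atTop (𝓝 μ)) (f : BoundedContinuousFunction Y ℝ≥0) :
    Tendsto (fun n => ∫⁻ x, ∑' i, (f (b x i) : ℝ≥0∞) ∂(ν n : Measure X)) atTop
      (𝓝 (∫⁻ x, ∑' i, (f (b x i) : ℝ≥0∞) ∂(μ : Measure X))) := by
  obtain ⟨C, hC⟩ : ∃ C : ℝ≥0, ∀ y, f y ≤ C := ⟨nndist f 0, fun y => BoundedContinuousFunction.NNReal.upper_bound f y⟩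
  have hle : ∀ x, ∑' i, (f (b x i) : ℝ≥0∞) ≤ ((D * C : ℝ≥0) : ℝ≥0∞) := fun x =>
    calc ∑' i, (f (b x i) : ℝ≥0∞) ≤ ∑' _ : ι x, (C : ℝ≥0∞) :=
          ENNReal.tsum_le_tsum fun i => ENNReal.coe_le_coe.2 (hC _)
      _ = (ENat.card (ι x) : ℝ≥0∞) * C := by rw [ENNReal.tsum_const]
      _ ≤ ((D * C : ℝ≥0) : ℝ≥0∞) := by
          push_cast
          gcongr
          simpa using ENat.toENNReal_le.2 (hD x)
  have hne : ∀ x, ∑' i, (f (b x i) : ℝ≥0∞) ≠ ∞ := fun x =>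
    ne_top_of_le_ne_top ENNReal.coe_ne_top (hle x)
  -- Weak convergence is tested on `ℝ≥0`-valued functions; the sums are finite, so `toNNReal` loses
  -- nothing.
  let g : BoundedContinuousFunction X ℝ≥0 := BoundedContinuousFunction.mkOfBound
    ⟨fun x => (∑' i, (f (b x i) : ℝ≥0∞)).toNNReal,
      continuous_iff_continuousAt.2 fun x => (ENNReal.tendsto_toNNReal (hne x)).comp
        (hb.continuous_tsum f.continuous).continuousAt⟩ (D * C : ℝ≥0) (fun x y => by
      have h : ∀ x, (∑' i, (f (b x i) : ℝ≥0∞)).toNNReal ≤ D * C := fun x =>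
        ENNReal.coe_le_coe.1 ((ENNReal.coe_toNNReal (hne x)).trans_le (hle x))
      rw [NNReal.dist_eq]
      exact abs_sub_le_of_nonneg_of_le (NNReal.coe_nonneg _) (NNReal.coe_le_coe.2 (h x))
        (NNReal.coe_nonneg _) (NNReal.coe_le_coe.2 (h y)))
  have hg : ∀ x, (g x : ℝ≥0∞) = ∑' i, (f (b x i) : ℝ≥0∞) := fun x =>
    ENNReal.coe_toNNReal (hne x)
  simpa only [hg] using ProbabilityMeasure.tendsto_iff_forall_lintegral_tendsto.1 hlim g

end PointFamily

/-! ### Agreement of balls and distance -/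

theorem agreementDist_le {X : Type*} {E : ℕ → X → X → Prop}
    (hm : ∀ r s x y, r ≤ s → E s x y → E r x y) (he : ∀ x y, (∀ s, E s x y) → x = y)
    {x y : X} {r : ℕ} (h : E r x y) : agreementDist E x y ≤ ((2 : ℝ) ^ r)⁻¹ := by
  by_cases hxy : x = y
  · rw [hxy, agreementDist_self]
    positivity
  · rw [agreementDist, if_neg hxy]
    exact inv_anti₀ (by positivity)
      (pow_le_pow_right₀ (by norm_num) (le_csSup (bddAbove_agreement hm he hxy) h))

theorem agreement_of_agreementDist_lt {X : Type*} {E : ℕ → X → X → Prop} (hr : ∀ s x, E s x x)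
    (hm : ∀ r s x y, r ≤ s → E s x y → E r x y) (he : ∀ x y, (∀ s, E s x y) → x = y)
    {x y : X} {r : ℕ} (h : agreementDist E x y < ((2 : ℝ) ^ r)⁻¹) : E r x y := by
  by_cases hxy : x = y
  · exact hxy ▸ hr r x
  rw [agreementDist, if_neg hxy, inv_lt_inv₀ (by positivity) (by positivity),
    pow_lt_pow_iff_right₀ (by norm_num)] at h
  refine hm _ _ _ _ h.le (Nat.sSup_mem ?_ (bddAbove_agreement hm he hxy))
  -- The supremum of the empty set is `0`, which cannot exceed `r`.
  by_contra hemp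
  simp [Set.not_nonempty_iff_eq_empty.1 hemp] at h

theorem BirootedGraph.dist_cls_le {Δ : ℕ} {G H : BirootedGraph Δ} {r : ℕ} (h : G.SameBall r H) :
    dist G.cls H.cls ≤ ((2 : ℝ) ^ r)⁻¹ := by
  rw [BiGr.dist_def]
  refine agreementDist_le ?_ ?_ (show BiGr.SameBall r G.cls H.cls from h)
  · rintro r s ⟨G⟩ ⟨H⟩ hrs h
    exact BallIso.mono G.connected H.connected hrs h
  · rintro ⟨G⟩ ⟨H⟩ h
    obtain ⟨φ, h0, h1⟩ := exists_iso_of_ballIso G.connected H.connected G.finite_neighborSet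
      H.finite_neighborSet h
    exact Quotient.sound ⟨φ, h0, h1⟩

theorem RootedGraph.sameBall_of_dist_lt {Δ : ℕ} {G H : RootedGraph Δ} {r : ℕ}
    (h : dist G.cls H.cls < ((2 : ℝ) ^ r)⁻¹) : G.SameBall r H := by
  rw [Gr.dist_def] at h
  refine (agreement_of_agreementDist_lt ?_ ?_ ?_ h : Gr.SameBall r G.cls H.cls)
  · rintro s ⟨G⟩
    exact RootedGraph.sameBall_of_equiv s (Setoid.refl G)
  · rintro r s ⟨G⟩ ⟨H⟩ hrs h
    exact RootedGraph.sameBall_iff.2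
      ((RootedGraph.sameBall_iff.1 h).mono G.connected H.connected hrs)
  · rintro ⟨G⟩ ⟨H⟩ h
    obtain ⟨φ, h0, -⟩ := exists_iso_of_ballIso G.connected H.connected G.finite_neighborSet
      H.finite_neighborSet fun s => RootedGraph.sameBall_iff.1 (h s)
    exact Quotient.sound ⟨φ, h0⟩

/-! ### Moving the root of a ball to a neighbour -/

section Recenter

variable {V W : Type} {G : SimpleGraph V} {H : SimpleGraph W} {o : V} {p : W} {r : ℕ}

theorem ballSet_subset_of_adj (hG : G.Connected) {x : V} (hx : G.Adj o x) :
    ballSet G x r ⊆ ballSet G o (r + 1) := fun y (hy : G.dist x y ≤ r) => by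
  have h : G.dist o y ≤ G.dist o x + G.dist x y := hG.dist_triangle
  rw [SimpleGraph.dist_eq_one_iff_adj.2 hx] at h
  exact show G.dist o y ≤ r + 1 by omega

theorem mem_ballSet_of_adj {x : V} (hx : G.Adj o x) : x ∈ ballSet G o (r + 1) := by
  simp [ballSet, SimpleGraph.dist_eq_one_iff_adj.2 hx]

theorem adj_ballIso (φ : ballGraph G o (r + 1) ≃g ballGraph H p (r + 1))
    (h0 : (φ ⟨o, center_mem G o (r + 1)⟩ : W) = p) {x : V} (hx : G.Adj o x) :
    H.Adj p (φ ⟨x, mem_ballSet_of_adj hx⟩) := by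
  have : (ballGraph H p (r + 1)).Adj (φ ⟨o, center_mem G o (r + 1)⟩)
      (φ ⟨x, mem_ballSet_of_adj hx⟩) := φ.map_rel_iff.2 hx
  have h : H.Adj (φ ⟨o, center_mem G o (r + 1)⟩) (φ ⟨x, mem_ballSet_of_adj hx⟩) := this
  rwa [h0] at h

/-- A geodesic of length at most `r` starting at `x` stays in the ball of radius `r + 1` around `o`,
so `φ` maps it to a walk of the same length in `H`. The induction follows this geodesic one edge at
a time. -/
theorem dist_ballIso_adj_le (hG : G.Connected) (hH : H.Connected)
    (φ : ballGraph G o (r + 1) ≃g ballGraph H p (r + 1)) {x : V} (hx : G.Adj o x) {y : V}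
    (hy : G.dist x y ≤ r) :
    H.dist (φ ⟨x, mem_ballSet_of_adj hx⟩) (φ ⟨y, ballSet_subset_of_adj hG hx hy⟩) ≤
      G.dist x y := by
  obtain ⟨n, hn⟩ : ∃ n, G.dist x y = n := ⟨_, rfl⟩
  induction n generalizing y with
  | zero =>
    obtain rfl := hG.dist_eq_zero_iff.1 hn
    simp
  | succ n ih =>
    obtain ⟨z, hz, hd⟩ := exists_adj_dist hG hn
    have hzr : G.dist x z ≤ r := by omega
    have h1 := ih hzr hd
    have h2 : H.Adj (φ ⟨z, ballSet_subset_of_adj hG hx hzr⟩)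
      (φ ⟨y, ballSet_subset_of_adj hG hx hy⟩) := φ.map_rel_iff.2 hz
    have h3 := hH.dist_triangle (u := (φ ⟨x, mem_ballSet_of_adj hx⟩ : W))
      (v := φ ⟨z, ballSet_subset_of_adj hG hx hzr⟩) (w := φ ⟨y, ballSet_subset_of_adj hG hx hy⟩)
    rw [SimpleGraph.dist_eq_one_iff_adj.2 h2] at h3
    omega

theorem dist_ballIso_symm_adj_le (hG : G.Connected) (hH : H.Connected)
    (φ : ballGraph G o (r + 1) ≃g ballGraph H p (r + 1))
    (h0 : (φ ⟨o, center_mem G o (r + 1)⟩ : W) = p) {x : V} (hx : G.Adj o x) {y : W}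
    (hy : H.dist (φ ⟨x, mem_ballSet_of_adj hx⟩) y ≤ r) :
    G.dist x (φ.symm ⟨y, ballSet_subset_of_adj hH (adj_ballIso φ h0 hx) hy⟩) ≤ r := by
  have h := dist_ballIso_adj_le hH hG φ.symm (adj_ballIso φ h0 hx) hy
  simp only [Subtype.coe_eta, RelIso.symm_apply_apply] at h
  exact h.trans hy

/-- Neither `φ` nor its inverse increases distances up to `r` from the new centers, so `φ` restricts
to the recentered balls. The old center becomes the second root; moving the center costs one unit of
radius. -/
theorem ballIso_of_adj (hG : G.Connected) (hH : H.Connected)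
    (φ : ballGraph G o (r + 1) ≃g ballGraph H p (r + 1))
    (h0 : (φ ⟨o, center_mem G o (r + 1)⟩ : W) = p) {x : V} (hx : G.Adj o x) :
    BallIso G x o H (φ ⟨x, mem_ballSet_of_adj hx⟩) p r := by
  refine ⟨⟨⟨fun y => ⟨φ ⟨y, ballSet_subset_of_adj hG hx y.2⟩,
      (dist_ballIso_adj_le hG hH φ hx y.2).trans y.2⟩,
    fun y => ⟨φ.symm ⟨y, ballSet_subset_of_adj hH (adj_ballIso φ h0 hx) y.2⟩,
      dist_ballIso_symm_adj_le hG hH φ h0 hx y.2⟩, fun y => ?_, fun y => ?_⟩, ?_⟩, rfl,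
    fun _ => h0⟩
  · simp
  · simp
  · intro y z
    exact φ.map_rel_iff (a := ⟨y, ballSet_subset_of_adj hG hx y.2⟩)
      (b := ⟨z, ballSet_subset_of_adj hG hx z.2⟩)

/-- An isomorphism of balls of positive radius restricts to a bijection between the neighbours of
the centers. -/
def ballNeighborEquiv (φ : ballGraph G o (r + 1) ≃g ballGraph H p (r + 1))
    (h0 : (φ ⟨o, center_mem G o (r + 1)⟩ : W) = p) : G.neighborSet o ≃ H.neighborSet p where
  toFun x := ⟨φ ⟨x, mem_ballSet_of_adj x.2⟩, adj_ballIso φ h0 x.2⟩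
  invFun y := ⟨φ.symm ⟨y, mem_ballSet_of_adj y.2⟩, adj_ballIso φ.symm (symm_center φ h0) y.2⟩
  left_inv x := by simp
  right_inv y := by simp

end Recenter

/-! ### The classes obtained by choosing a neighbour of the root -/

/-- A representative of `γ`. -/
noncomputable def Gr.out {Δ : ℕ} (γ : Gr Δ) : RootedGraph Δ := Quotient.out γ

theorem Gr.out_cls {Δ : ℕ} (γ : Gr Δ) : γ.out.cls = γ := Quotient.out_eq γ

/-- The neighbours of the root of a representative of `γ`. -/
abbrev Gr.Neighbor {Δ : ℕ} (γ : Gr Δ) : Type :=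
  γ.out.graph.neighborSet γ.out.root

instance {Δ : ℕ} (γ : Gr Δ) : Finite γ.Neighbor :=
  (γ.out.finite_neighborSet _).to_subtype

theorem Gr.card_neighbor_le {Δ : ℕ} (γ : Gr Δ) : ENat.card γ.Neighbor ≤ Δ :=
  γ.out.degree_le _

/-- The classes `[G, o, x]` for `x ∈ N_G(o)`. -/
noncomputable def Gr.outward {Δ : ℕ} (γ : Gr Δ) (x : γ.Neighbor) : BiGr Δ :=
  (γ.out.birooted _ x x.2).cls

/-- The classes `[G, x, o]` for `x ∈ N_G(o)`. -/
noncomputable def Gr.inward {Δ : ℕ} (γ : Gr Δ) (x : γ.Neighbor) : BiGr Δ :=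
  (γ.out.birooted x _ x.2.symm).cls

/-- Expresses the sum lifted from the quotient through a family indexed by the neighbours in one
chosen representative, the form to which `LocallyStable` applies. -/
theorem outSum_eq {Δ : ℕ} (f : BiGr Δ → ℝ≥0) (γ : Gr Δ) :
    outSum f γ = ∑' x, (f (γ.outward x) : ℝ≥0∞) := by
  conv_lhs => rw [← γ.out_cls]
  rfl

theorem inSum_eq {Δ : ℕ} (f : BiGr Δ → ℝ≥0) (γ : Gr Δ) :
    inSum f γ = ∑' x, (f (γ.inward x) : ℝ≥0∞) := by
  conv_lhs => rw [← γ.out_cls]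
  rfl

theorem Gr.eventually_sameBall {Δ : ℕ} (γ : Gr Δ) (r : ℕ) :
    ∀ᶠ δ in 𝓝 γ, γ.out.SameBall r δ.out := by
  filter_upwards [Metric.ball_mem_nhds γ (show 0 < ((2 : ℝ) ^ r)⁻¹ by positivity)] with δ hδ
  refine RootedGraph.sameBall_of_dist_lt ?_
  rwa [Metric.mem_ball, dist_comm, ← γ.out_cls, ← δ.out_cls] at hδ

theorem exists_inv_two_pow_lt {ε : ℝ} (hε : 0 < ε) : ∃ r : ℕ, ((2 : ℝ) ^ r)⁻¹ < ε := by
  obtain ⟨r, hr⟩ := exists_pow_lt_of_lt_one hε (show (2 : ℝ)⁻¹ < 1 by norm_num)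
  exact ⟨r, by rwa [← inv_pow]⟩

theorem locallyStable_outward (Δ : ℕ) : LocallyStable (Gr.outward (Δ := Δ)) := by
  intro γ ε hε
  obtain ⟨r, hr⟩ := exists_inv_two_pow_lt hε
  -- The center does not move here; `r + 1` only ensures that the ball contains all neighbours of
  -- the root, even for `r = 0`.
  filter_upwards [γ.eventually_sameBall (r + 1)] with δ h
  obtain ⟨φ, h0, -⟩ := RootedGraph.sameBall_iff.1 h
  refine ⟨ballNeighborEquiv φ h0, fun x => lt_of_le_of_lt ?_ hr⟩
  rw [dist_comm]
  exact BirootedGraph.dist_cls_le (BallIso.mono γ.out.connected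
    δ.out.connected r.le_succ ⟨φ, h0, fun _ => rfl⟩)

theorem locallyStable_inward (Δ : ℕ) : LocallyStable (Gr.inward (Δ := Δ)) := by
  intro γ ε hε
  obtain ⟨r, hr⟩ := exists_inv_two_pow_lt hε
  -- Here the extra unit of radius also pays for moving the center to a neighbour.
  filter_upwards [γ.eventually_sameBall (r + 1)] with δ h
  obtain ⟨φ, h0, -⟩ := RootedGraph.sameBall_iff.1 h
  refine ⟨ballNeighborEquiv φ h0, fun x => lt_of_le_of_lt ?_ hr⟩
  rw [dist_comm]
  exact BirootedGraph.dist_cls_le (ballIso_of_adj γ.out.connected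
    δ.out.connected φ h0 x.2)

end BoundedDegree

/-! ### Passage to the weak limit -/

theorem mainTheorem1 (Δ : ℕ) (ν : ℕ → ProbabilityMeasure (BoundedDegree.Gr Δ))
    (μ : ProbabilityMeasure (BoundedDegree.Gr Δ))
    (hν : ∀ n, BoundedDegree.IsUnimodular (ν n : Measure (BoundedDegree.Gr Δ)))
    (hlim : Tendsto ν atTop (𝓝 μ)) :
    BoundedDegree.IsUnimodular (μ : Measure (BoundedDegree.Gr Δ)) := by
  open BoundedDegree in
  have hin := locallyStable_inward Δ
  have hout := locallyStable_outward Δ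
  have := hin.isFiniteMeasure_bind Gr.card_neighbor_le (μ : Measure (Gr Δ))
  have hbind : (μ : Measure (Gr Δ)).bind (diracSum Gr.inward) =
      (μ : Measure (Gr Δ)).bind (diracSum Gr.outward) := by
    refine ext_of_forall_lintegral_eq_of_IsFiniteMeasure fun f => ?_
    rw [hin.lintegral_bind _ f.continuous.measurable, hout.lintegral_bind _ f.continuous.measurable]
    -- By unimodularity of each `ν n`, the inward and outward integrals form the same sequence, so
    -- their limits agree.
    refine tendsto_nhds_unique (hin.tendsto_lintegral Gr.card_neighbor_le hlim f) ?_
    simpa only [← inSum_eq, ← outSum_eq, hν _ f f.continuous.measurable] using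
      hout.tendsto_lintegral Gr.card_neighbor_le hlim f
  intro f hf
  simp_rw [inSum_eq, outSum_eq]
  rw [← hin.lintegral_bind _ hf, ← hout.lintegral_bind _ hf, hbind]
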